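/- Let $\mathbf{k}$ be an algebraically closed field of characteristic $0$ and let $(H,\cdot,1,\Delta,\varepsilon,S)$ be a cocommutative Hopf algebra over $\mathbf{k}$, with Sweedler notation $\Delta(x)=x_1\otimes x_2$. Let $(H,\rhd)$ be a post-Hopf algebra, i.e. $\rhd\colon H\otimes H\to H$ is a coalgebra homomorphism such that for all $x,y,z\in H$ $$x\rhd(y\cdot z)=(x_1\rhd y)\cdot(x_2\rhd z),\qquad x\rhd(y\rhd z)=\big(x_1\cdot(x_2\rhd y)\big)\rhd z,$$ and the map $\alpha\colon H\to\operatorname{End}(H)$, $\alpha_x(y)=x\rhd y$, is convolution invertible in $\operatorname{Hom}(H,\operatorname{End}(H))$; that is, there is a (necessarily unique) linear map $\beta\colon H\to\operatorname{End}(H)$ with $\alpha_{x_1}\beta_{x_2}=\beta_{x_1}\alpha_{x_2}=\varepsilon(x)\,\mathrm{id}_H$ for all $x\in H$. For $x,y\in H$ put $$x*_\rhd y=x_1\cdot(x_2\rhd y),\qquad S_\rhd(x)=\beta_{x_1}(S(x_2)),\qquad x\lhd y=S_\rhd(x_1\rhd y_1)*_\rhd (x_2*_\rhd y_2).$$ Then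 the linear map $R\colon H\otimes H\to H\otimes H$ defined by $$R(x\otimes y)=(x_1\rhd y_1)\otimes(x_2\lhd y_2)$$ is a coalgebra isomorphism, and it is a solution of the Yang–Baxter equation on the vector space $H$: it is invertible and $$(R\otimes\mathrm{id})(\mathrm{id}\otimes R)(R\otimes\mathrm{id})=(\mathrm{id}\otimes R)(R\otimes\mathrm{id})(\mathrm{id}\otimes R)\quad\text{on } H\otimes H\otimes H.$$ -/

import Mathlib

open scoped TensorProduct

/-- A post-Hopf algebra structure on a Hopf algebra `H` over `k`: a coalgebra homomorphism
`▷ : H ⊗ H → H` such that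
`x ▷ (y z) = (x₁ ▷ y) (x₂ ▷ z)` and `x ▷ (y ▷ z) = (x₁ (x₂ ▷ y)) ▷ z`,
and such that `x ↦ (y ↦ x ▷ y)` is invertible for the convolution product of `Hom(H, End H)`
(where `End H` carries composition). -/
structure PostHopfAlgebra (k H : Type*) [Field k] [Ring H] [HopfAlgebra k H] where
  /-- the product `▷`, as a coalgebra homomorphism `H ⊗ H → H` -/
  act : H ⊗[k] H →ₗc[k] H
  act_mul : ∀ x y z : H,
    act (x ⊗ₜ[k] (y * z)) =
      LinearMap.mul' k H
        (TensorProduct.map act.toLinearMap act.toLinearMap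
          (TensorProduct.tensorTensorTensorComm k H H H H
            (Coalgebra.comul (R := k) x ⊗ₜ[k] (y ⊗ₜ[k] z))))
  act_act : ∀ x y z : H,
    act (x ⊗ₜ[k] act (y ⊗ₜ[k] z)) =
      act (LinearMap.mul' k H
        (LinearMap.lTensor H act.toLinearMap
          (TensorProduct.assoc k H H H (Coalgebra.comul (R := k) x ⊗ₜ[k] y))) ⊗ₜ[k] z)
  isUnit_conv :
    IsUnit (WithConv.toConv (TensorProduct.curry act.toLinearMap : H →ₗ[k] Module.End k H))

namespace PostHopfAlgebra

variable {k H : Type*} [Field k] [Ring H] [HopfAlgebra k H] (P : PostHopfAlgebra k H)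

/-- `α : H → End H`, `α_x y = x ▷ y`. -/
def leftMul : H →ₗ[k] Module.End k H :=
  TensorProduct.curry P.act.toLinearMap

/-- `β : H → End H`, the convolution inverse of `α`. -/
noncomputable def convInv : H →ₗ[k] Module.End k H :=
  (↑(P.isUnit_conv.unit⁻¹) : WithConv (H →ₗ[k] Module.End k H)).ofConv

/-- The defining property of `β`: `α_{x₁} β_{x₂} = β_{x₁} α_{x₂} = ε(x) id`. -/
theorem leftMul_conv_convInv :
    WithConv.toConv P.leftMul * WithConv.toConv P.convInv = 1 ∧
      WithConv.toConv P.convInv * WithConv.toConv P.leftMul = 1 :=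
  ⟨P.isUnit_conv.mul_val_inv, P.isUnit_conv.val_inv_mul⟩

/-- The subadjacent product `x * y = x₁ (x₂ ▷ y)`, as a linear map on `H ⊗ H`. -/
noncomputable def star : H ⊗[k] H →ₗ[k] H :=
  LinearMap.mul' k H ∘ₗ
    LinearMap.lTensor H P.act.toLinearMap ∘ₗ
      (TensorProduct.assoc k H H H).toLinearMap ∘ₗ
        LinearMap.rTensor H (Coalgebra.comul (R := k) (A := H))

/-- The subadjacent antipode `x ↦ β_{x₁} (S x₂)`. -/
noncomputable def subAntipode : H →ₗ[k] H :=
  TensorProduct.lift P.convInv ∘ₗ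
    LinearMap.lTensor H (HopfAlgebra.antipode k (A := H)) ∘ₗ
      Coalgebra.comul (R := k) (A := H)

/-- `x ◁ y = S_▷ (x₁ ▷ y₁) * (x₂ * y₂)`, where `*` is the subadjacent product.
The comultiplication used is that of `H ⊗ H`, `x ⊗ y ↦ (x₁ ⊗ y₁) ⊗ (x₂ ⊗ y₂)`. -/
noncomputable def rightAct : H ⊗[k] H →ₗ[k] H :=
  P.star ∘ₗ
    TensorProduct.map (P.subAntipode ∘ₗ P.act.toLinearMap) P.star ∘ₗ
      Coalgebra.comul (R := k) (A := H ⊗[k] H)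

/-- `R (x ⊗ y) = (x₁ ▷ y₁) ⊗ (x₂ ◁ y₂)`. -/
noncomputable def braiding : H ⊗[k] H →ₗ[k] H ⊗[k] H :=
  TensorProduct.map P.act.toLinearMap P.rightAct ∘ₗ
    Coalgebra.comul (R := k) (A := H ⊗[k] H)

end PostHopfAlgebra

/-- `R : V ⊗ V → V ⊗ V` is a solution of the Yang-Baxter equation on `V`: it is invertible and
`(R ⊗ id)(id ⊗ R)(R ⊗ id) = (id ⊗ R)(R ⊗ id)(id ⊗ R)` on `V ⊗ V ⊗ V = V ⊗ (V ⊗ V)`. -/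
def IsYangBaxterSolution {k V : Type*} [Field k] [AddCommGroup V] [Module k V]
    (R : V ⊗[k] V →ₗ[k] V ⊗[k] V) : Prop :=
  Function.Bijective R ∧
    let R₁₂ : V ⊗[k] (V ⊗[k] V) →ₗ[k] V ⊗[k] (V ⊗[k] V) :=
      (TensorProduct.assoc k V V V).toLinearMap ∘ₗ LinearMap.rTensor V R ∘ₗ
        (TensorProduct.assoc k V V V).symm.toLinearMap
    let R₂₃ : V ⊗[k] (V ⊗[k] V) →ₗ[k] V ⊗[k] (V ⊗[k] V) := LinearMap.lTensor V R
    R₁₂ ∘ₗ R₂₃ ∘ₗ R₁₂ = R₂₃ ∘ₗ R₁₂ ∘ₗ R₂₃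

/-!
For a cocommutative coalgebra `C` the tensor product is a categorical product, and a cocommutative
Hopf algebra is a group object: the coalgebra homomorphisms `C → H` form a group under convolution
(`CoalgHom.convGroup`). By the Yoneda principle a post-Hopf algebra structure on `H` amounts to a
natural post-group structure on these groups (`PostHopfAlgebra.postGroup`), and the theorem is
reduced to its analogue for post-groups, that is, for sets. Below, a *point* of `H` is a coalgebra
homomorphism `C → H`.

In a post-group, `x * y = x (x ▷ y)` is a second group structure, `▷` is an action of it, and
`x ▷ (y * z) = (x ▷ y) * ((x ◁ y) ▷ z)` where `x * y = (x ▷ y) * (x ◁ y)`. Hence `◁` is a right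
action, and two of the three components of the braid relation for `(x, y) ↦ (x ▷ y, x ◁ y)` follow;
the remaining one holds because the braiding preserves products (`braid_relation_of_act`). The
inverse sends `(u, v)` to `(x, y)` with `x = (u * v) u⁻¹` and `x ▷ y = u`.

Two maps have to be shown to be coalgebra homomorphisms before they operate on points: the
antipode, and `x ⊗ y ↦ β_x y` for the convolution inverse `β` of `▷`. Both are instances of
`exists_coalgHom_eq_lift_of_conv_inverse`. The identities on `H ⊗ H` and `H ⊗ H ⊗ H` are then
obtained by evaluation at the universal points, the projections to the factors.
-/

/-! ### Post-groups -/

/-- A braided group: a group `G` acting on its underlying set by `x ▷ y = act x y` so that, with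
`x ◁ y = (x ▷ y)⁻¹ x y`, one has `x ▷ (y z) = (x ▷ y) ((x ◁ y) ▷ z)`. Then
`(x, y) ↦ (x ▷ y, x ◁ y)` satisfies the braid relation; the three conjuncts are its three
components. -/
theorem braid_relation_of_act {G : Type*} [Group G] (act : G → G → G)
    (mul_act : ∀ x y z, act (x * y) z = act x (act y z))
    (act_mul : ∀ x y z, act x (y * z) = act x y * act ((act x y)⁻¹ * (x * y)) z) (x y z : G) :
    let r : G → G → G := fun x y => (act x y)⁻¹ * (x * y)
    act (act x y) (act (r x y) z) = act x (act y z) ∧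
      r (act x y) (act (r x y) z) = act (r x (act y z)) (r y z) ∧
        r (r x y) z = r (r x (act y z)) (r y z) := by
  intro r
  have act_r : ∀ a b, act a b * r a b = a * b := fun a b => mul_inv_cancel_left _ _
  have h₁ : ∀ a b c, act (act a b) (act (r a b) c) = act a (act b c) := fun a b c => by
    rw [← mul_act, act_r, mul_act]
  -- `◁` is a right action of `G`; the third component is its value on `y z = (y ▷ z) (y ◁ z)`.
  have r_mul : ∀ a b c, r a (b * c) = r (r a b) c := fun a b c => by
    change (act a (b * c))⁻¹ * (a * (b * c)) = (act (r a b) c)⁻¹ * (r a b * c)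
    rw [act_mul]
    change (act a b * act (r a b) c)⁻¹ * _ = (act (r a b) c)⁻¹ * ((act a b)⁻¹ * (a * b) * c)
    group
  have h₃ : r (r x y) z = r (r x (act y z)) (r y z) := by
    rw [← r_mul, ← r_mul, act_r]
  refine ⟨h₁ x y z, ?_, h₃⟩
  -- Both triples have product `x y z`, so their middle entries agree as the outer ones do.
  have e₁ : act x (act y z) * r (act x y) (act (r x y) z) * r (r x y) z = x * y * z := by
    rw [← h₁, act_r, mul_assoc, act_r, ← mul_assoc, act_r]
  have e₂ : act x (act y z) * act (r x (act y z)) (r y z) * r (r x y) z = x * y * z := by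
    rw [h₃, mul_assoc, act_r, ← mul_assoc, act_r, mul_assoc, act_r, mul_assoc]
  exact mul_left_cancel (mul_right_cancel (e₁.trans e₂.symm))

/-- A post-group structure on a group `G`: an operation `x ▷ y = act x y` with
`x ▷ (y z) = (x ▷ y) (x ▷ z)` and `x ▷ (y ▷ z) = (x (x ▷ y)) ▷ z`, all of whose left translations
`x ▷ ·` are invertible, with inverse `actInv x`. -/
structure PostGroup (G : Type*) [Group G] where
  /-- the operation `▷` -/
  act : G → G → G
  /-- the inverse of the left translation by the first argument -/
  actInv : G → G → G
  act_mul : ∀ x y z, act x (y * z) = act x y * act x z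
  act_act : ∀ x y z, act x (act y z) = act (x * act x y) z
  act_actInv : ∀ x y, act x (actInv x y) = y
  actInv_act : ∀ x y, actInv x (act x y) = y

namespace PostGroup

variable {G : Type*} [Group G] (Q : PostGroup G)

/-- The subadjacent product `x * y = x (x ▷ y)`. -/
def star (x y : G) : G := x * Q.act x y

/-- The inverse for the subadjacent product. -/
def starInv (x : G) : G := Q.actInv x x⁻¹

/-- `x ◁ y = (x ▷ y)⁻¹ * x * y`, computed with the subadjacent product. -/
def rightAct (x y : G) : G := Q.star (Q.starInv (Q.act x y)) (Q.star x y)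

theorem act_one (x : G) : Q.act x 1 = 1 := by
  simpa using Q.act_mul x 1 1

theorem star_act (x y z : G) : Q.act (Q.star x y) z = Q.act x (Q.act y z) :=
  (Q.act_act x y z).symm

/-- The subadjacent group: `G` with the product `star`. A definition rather than an instance, as `G`
already carries its original product. -/
abbrev subadjacentGroup : Group G :=
  @Group.ofRightAxioms G ⟨Q.star⟩ ⟨Q.starInv⟩ ⟨1⟩
    (fun x y z => show Q.star (Q.star x y) z = Q.star x (Q.star y z) by
      rw [star, star_act, star, star, star, Q.act_mul, mul_assoc])
    (fun x => show Q.star x 1 = x by rw [star, Q.act_one, mul_one])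
    (fun x => show Q.star x (Q.starInv x) = 1 by rw [star, starInv, Q.act_actInv, mul_inv_cancel])

theorem star_starInv_star (x y : G) : Q.star x (Q.star (Q.starInv x) y) = y :=
  @mul_inv_cancel_left G Q.subadjacentGroup x y

theorem starInv_star_star (x y : G) : Q.star (Q.starInv x) (Q.star x y) = y :=
  @inv_mul_cancel_left G Q.subadjacentGroup x y

theorem star_act_rightAct (x y : G) : Q.star (Q.act x y) (Q.rightAct x y) = Q.star x y :=
  Q.star_starInv_star _ _

theorem act_star (x y z : G) :
    Q.act x (Q.star y z) = Q.star (Q.act x y) (Q.act (Q.rightAct x y) z) := by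
  rw [star, Q.act_mul, star, ← Q.star_act (Q.act x y), star_act_rightAct, star_act]

theorem braid_relation (x y z : G) :
    Q.act (Q.act x y) (Q.act (Q.rightAct x y) z) = Q.act x (Q.act y z) ∧
      Q.rightAct (Q.act x y) (Q.act (Q.rightAct x y) z) =
          Q.act (Q.rightAct x (Q.act y z)) (Q.rightAct y z) ∧
        Q.rightAct (Q.rightAct x y) z =
          Q.rightAct (Q.rightAct x (Q.act y z)) (Q.rightAct y z) :=
  @braid_relation_of_act G Q.subadjacentGroup Q.act Q.star_act Q.act_star x y z

/-- The first component of the inverse of `(x, y) ↦ (x ▷ y, x ◁ y)`. If `u = x ▷ y` and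
`v = x ◁ y`, then `u * v = x * y = x u` in the subadjacent group, which determines `x`. -/
def braidInvFst (u v : G) : G := Q.star u v * u⁻¹

/-- The second component of the inverse of `(x, y) ↦ (x ▷ y, x ◁ y)`. -/
def braidInvSnd (u v : G) : G := Q.actInv (Q.braidInvFst u v) u

theorem act_braidInv (u v : G) : Q.act (Q.braidInvFst u v) (Q.braidInvSnd u v) = u :=
  Q.act_actInv _ _

theorem rightAct_braidInv (u v : G) :
    Q.rightAct (Q.braidInvFst u v) (Q.braidInvSnd u v) = v := by
  have h : Q.star (Q.braidInvFst u v) (Q.braidInvSnd u v) = Q.star u v := by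
    rw [star, act_braidInv, braidInvFst, inv_mul_cancel_right]
  rw [rightAct, act_braidInv, h, starInv_star_star]

theorem braidInvFst_braid (x y : G) : Q.braidInvFst (Q.act x y) (Q.rightAct x y) = x := by
  rw [braidInvFst, star_act_rightAct, star, mul_inv_cancel_right]

theorem braidInvSnd_braid (x y : G) : Q.braidInvSnd (Q.act x y) (Q.rightAct x y) = y := by
  rw [braidInvSnd, braidInvFst_braid, Q.actInv_act]

end PostGroup

/-! ### Maps into tensor products of coalgebras -/

section ComulPair

open Coalgebra

variable {k A B C D E : Type*} [Field k] [AddCommGroup A] [Module k A] [AddCommGroup B]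
  [Module k B] [AddCommGroup C] [Module k C] [Coalgebra k C] [AddCommGroup D] [Module k D]
  [AddCommGroup E] [Module k E]

/-- The pairing `c ↦ f c₁ ⊗ g c₂` of two linear maps defined on a coalgebra. -/
noncomputable def LinearMap.comulPair (f : C →ₗ[k] A) (g : C →ₗ[k] B) : C →ₗ[k] A ⊗[k] B :=
  TensorProduct.map f g ∘ₗ comul

namespace LinearMap

theorem map_comp_comulPair (u : A →ₗ[k] D) (v : B →ₗ[k] E) (f : C →ₗ[k] A) (g : C →ₗ[k] B) :
    TensorProduct.map u v ∘ₗ comulPair f g = comulPair (u ∘ₗ f) (v ∘ₗ g) := by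
  rw [comulPair, comulPair, TensorProduct.map_comp, comp_assoc]

theorem lTensor_comp_comulPair (v : B →ₗ[k] E) (f : C →ₗ[k] A) (g : C →ₗ[k] B) :
    lTensor A v ∘ₗ comulPair f g = comulPair f (v ∘ₗ g) :=
  map_comp_comulPair id v f g

theorem rTensor_comp_comulPair (u : A →ₗ[k] D) (f : C →ₗ[k] A) (g : C →ₗ[k] B) :
    rTensor B u ∘ₗ comulPair f g = comulPair (u ∘ₗ f) g :=
  map_comp_comulPair u id f g

theorem comulPair_comp_coalgHom [Coalgebra k B] (f : C →ₗ[k] A) (g : C →ₗ[k] D) (h : B →ₗc[k] C) :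
    comulPair f g ∘ₗ h.toLinearMap = comulPair (f ∘ₗ h.toLinearMap) (g ∘ₗ h.toLinearMap) := by
  rw [comulPair, comp_assoc, ← h.map_comp_comul, ← comp_assoc, ← TensorProduct.map_comp, comulPair]

theorem comul_comp_coalgHom [Coalgebra k A] (f : C →ₗc[k] A) :
    comul ∘ₗ f.toLinearMap = comulPair f.toLinearMap f.toLinearMap :=
  f.map_comp_comul.symm

theorem assoc_comp_comulPair (f : C →ₗ[k] A) (g : C →ₗ[k] B) (h : C →ₗ[k] D) :
    (TensorProduct.assoc k A B D).toLinearMap ∘ₗ comulPair (comulPair f g) h =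
      comulPair f (comulPair g h) := by
  have e₁ : comulPair (comulPair f g) h =
      TensorProduct.map (TensorProduct.map f g) h ∘ₗ rTensor C comul ∘ₗ comul := by
    rw [← comp_assoc, rTensor, ← TensorProduct.map_comp]; rfl
  have e₂ : comulPair f (comulPair g h) =
      TensorProduct.map f (TensorProduct.map g h) ∘ₗ lTensor C comul ∘ₗ comul := by
    rw [← comp_assoc, lTensor, ← TensorProduct.map_comp]; rfl
  rw [e₁, e₂, ← Coalgebra.coassoc, ← comp_assoc, ← TensorProduct.map_map_comp_assoc_eq, comp_assoc]

theorem assoc_symm_comp_comulPair (f : C →ₗ[k] A) (g : C →ₗ[k] B) (h : C →ₗ[k] D) :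
    (TensorProduct.assoc k A B D).symm.toLinearMap ∘ₗ comulPair f (comulPair g h) =
      comulPair (comulPair f g) h := by
  rw [← assoc_comp_comulPair, ← comp_assoc, LinearEquiv.symm_comp, id_comp]

theorem comulPair_comulPair_comulPair (f : C →ₗ[k] A) (g : C →ₗ[k] B) (h : C →ₗ[k] D)
    (l : C →ₗ[k] E) :
    comulPair (comulPair f g) (comulPair h l) =
      TensorProduct.map (TensorProduct.map f g) (TensorProduct.map h l) ∘ₗ
        TensorProduct.map comul comul ∘ₗ comul := by
  rw [← comp_assoc, ← TensorProduct.map_comp]; rfl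

/-- In a cocommutative coalgebra the iterated coproduct is invariant under the exchange of its two
middle tensor factors. -/
theorem tensorTensorTensorComm_comp_comulPair [IsCocomm k C] (f : C →ₗ[k] A) (g : C →ₗ[k] B)
    (h : C →ₗ[k] D) (l : C →ₗ[k] E) :
    (TensorProduct.tensorTensorTensorComm k A B D E).toLinearMap ∘ₗ
        comulPair (comulPair f g) (comulPair h l) =
      comulPair (comulPair f h) (comulPair g l) := by
  have e : (TensorProduct.tensorTensorTensorComm k C C C C).toLinearMap ∘ₗ
      TensorProduct.map comul comul ∘ₗ comul = TensorProduct.map comul comul ∘ₗ comul (A := C) :=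
    (comulCoalgHom k C).map_comp_comul.symm
  rw [comulPair_comulPair_comulPair, comulPair_comulPair_comulPair, ← comp_assoc,
    TensorProduct.tensorTensorTensorComm_comp_map, comp_assoc, e]

end LinearMap

namespace CoalgHom

open LinearMap

variable [Coalgebra k A] [Coalgebra k B] [Coalgebra k D]

/-- The pairing `c ↦ f c₁ ⊗ g c₂` of two coalgebra homomorphisms defined on a cocommutative
coalgebra, as a coalgebra homomorphism: the tensor product is the categorical product of
cocommutative coalgebras. -/
noncomputable def comulPair [IsCocomm k C] (f : C →ₗc[k] A) (g : C →ₗc[k] B) :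
    C →ₗc[k] A ⊗[k] B :=
  (Coalgebra.TensorProduct.map f g).comp (comulCoalgHom k C)

theorem toLinearMap_comulPair [IsCocomm k C] (f : C →ₗc[k] A) (g : C →ₗc[k] B) :
    (comulPair f g).toLinearMap = LinearMap.comulPair f.toLinearMap g.toLinearMap :=
  rfl

theorem toLinearMap_comp (f : A →ₗc[k] B) (g : D →ₗc[k] A) :
    (f.comp g).toLinearMap = f.toLinearMap ∘ₗ g.toLinearMap :=
  rfl

theorem toLinearMap_injective :
    Function.Injective (CoalgHom.toLinearMap : (A →ₗc[k] B) → A →ₗ[k] B) :=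
  fun _ _ h => CoalgHom.ext fun x => LinearMap.congr_fun h x

theorem comulPair_comp [IsCocomm k C] [IsCocomm k D] (f : C →ₗc[k] A) (g : C →ₗc[k] B)
    (h : D →ₗc[k] C) : (comulPair f g).comp h = comulPair (f.comp h) (g.comp h) :=
  toLinearMap_injective (comulPair_comp_coalgHom f.toLinearMap g.toLinearMap h)

variable (k A B) in
/-- The projection `x ⊗ y ↦ ε(y) x` of a tensor product of coalgebras to its first factor. -/
noncomputable def fst : A ⊗[k] B →ₗc[k] A :=
  (Coalgebra.TensorProduct.rid k k A : A ⊗[k] k →ₗc[k] A).comp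
    (Coalgebra.TensorProduct.map (CoalgHom.id k A) (counitCoalgHom k B))

variable (k A B) in
/-- The projection `x ⊗ y ↦ ε(x) y` of a tensor product of coalgebras to its second factor. -/
noncomputable def snd : A ⊗[k] B →ₗc[k] B :=
  (Coalgebra.TensorProduct.lid k B : k ⊗[k] B →ₗc[k] B).comp
    (Coalgebra.TensorProduct.map (counitCoalgHom k A) (CoalgHom.id k B))

theorem fst_tmul (a : A) (b : B) : fst k A B (a ⊗ₜ b) = counit (R := k) b • a :=
  rfl

theorem snd_tmul (a : A) (b : B) : snd k A B (a ⊗ₜ b) = counit (R := k) a • b :=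
  rfl

theorem fst_comp_comulPair [IsCocomm k C] (f : C →ₗc[k] A) (g : C →ₗc[k] B) :
    (fst k A B).comp (comulPair f g) = f := by
  have h : (fst k A B).toLinearMap ∘ₗ TensorProduct.map f.toLinearMap g.toLinearMap =
      f.toLinearMap ∘ₗ (TensorProduct.rid k C).toLinearMap ∘ₗ LinearMap.lTensor C counit := by
    refine TensorProduct.ext' fun a b => ?_
    change fst k A B (f a ⊗ₜ g b) = f (counit (R := k) b • a)
    rw [fst_tmul, CoalgHomClass.counit_comp_apply, map_smul]
  ext c
  refine (LinearMap.congr_fun h (comul (R := k) c)).trans ?_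
  change f (TensorProduct.rid k C (LinearMap.lTensor C counit (comul (R := k) c))) = f c
  rw [lTensor_counit_comul, TensorProduct.rid_tmul, one_smul]

theorem snd_comp_comulPair [IsCocomm k C] (f : C →ₗc[k] A) (g : C →ₗc[k] B) :
    (snd k A B).comp (comulPair f g) = g := by
  have h : (snd k A B).toLinearMap ∘ₗ TensorProduct.map f.toLinearMap g.toLinearMap =
      g.toLinearMap ∘ₗ (TensorProduct.lid k C).toLinearMap ∘ₗ LinearMap.rTensor C counit := by
    refine TensorProduct.ext' fun a b => ?_
    change snd k A B (f a ⊗ₜ g b) = g (counit (R := k) a • b)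
    rw [snd_tmul, CoalgHomClass.counit_comp_apply, map_smul]
  ext c
  refine (LinearMap.congr_fun h (comul (R := k) c)).trans ?_
  change g (TensorProduct.lid k C (LinearMap.rTensor C counit (comul (R := k) c))) = g c
  rw [rTensor_counit_comul, TensorProduct.lid_tmul, one_smul]

theorem comulPair_fst_snd [IsCocomm k A] [IsCocomm k B] :
    comulPair (fst k A B) (snd k A B) = CoalgHom.id k (A ⊗[k] B) := by
  have h : TensorProduct.map (fst k A B).toLinearMap (snd k A B).toLinearMap ∘ₗ
        (TensorProduct.tensorTensorTensorComm k A A B B).toLinearMap =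
      TensorProduct.map
        ((TensorProduct.rid k A).toLinearMap ∘ₗ LinearMap.lTensor A counit)
        ((TensorProduct.lid k B).toLinearMap ∘ₗ LinearMap.rTensor B counit) := by
    refine TensorProduct.ext_fourfold' fun a a' b b' => ?_
    change (counit (R := k) b • a) ⊗ₜ[k] (counit (R := k) a' • b') =
      (counit (R := k) a' • a) ⊗ₜ[k] (counit (R := k) b • b')
    rw [TensorProduct.smul_tmul_smul, TensorProduct.smul_tmul_smul, mul_comm]
  apply toLinearMap_injective
  refine TensorProduct.ext' fun a b => ?_
  refine (LinearMap.congr_fun h (comul a ⊗ₜ comul b)).trans ?_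
  change TensorProduct.rid k A (LinearMap.lTensor A counit (comul a)) ⊗ₜ
    TensorProduct.lid k B (LinearMap.rTensor B counit (comul b)) = a ⊗ₜ b
  rw [lTensor_counit_comul, rTensor_counit_comul, TensorProduct.rid_tmul, TensorProduct.lid_tmul,
    one_smul, one_smul]

end CoalgHom
end ComulPair

/-! ### Convolution-invertible actions on a coalgebra -/

section ConvInverse

open Coalgebra WithConv

variable {k C M D : Type*} [Field k] [AddCommGroup C] [Module k C] [Coalgebra k C]
  [AddCommGroup M] [Module k M] [AddCommGroup D] [Module k D] [Coalgebra k D]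

theorem TensorProduct.lift_convMul (a b : WithConv (C →ₗ[k] Module.End k M)) :
    TensorProduct.lift (a * b).ofConv =
      TensorProduct.lift a.ofConv ∘ₗ LinearMap.lTensor C (TensorProduct.lift b.ofConv) ∘ₗ
        (TensorProduct.assoc k C C M).toLinearMap ∘ₗ LinearMap.rTensor M comul := by
  refine TensorProduct.ext' fun c m => ?_
  have h : ∀ u : C ⊗[k] C,
      LinearMap.mul' k (Module.End k M) (TensorProduct.map a.ofConv b.ofConv u) m =
        TensorProduct.lift a.ofConv (LinearMap.lTensor C (TensorProduct.lift b.ofConv)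
          (TensorProduct.assoc k C C M (u ⊗ₜ m))) := fun u => by
    induction u with
    | zero => simp
    | tmul x y => simp
    | add u v hu hv => simp only [map_add, LinearMap.add_apply, TensorProduct.add_tmul, hu, hv]
  exact h (comul c)

/-- A convolution product acts on `f ⊗ g` by successive action of its factors:
`(a * b)_{f d₁} (g d₂) = a_{f d₁} (b_{f d₂} (g d₃))`. -/
theorem TensorProduct.lift_convMul_comp_comulPair (a b : WithConv (C →ₗ[k] Module.End k M))
    (f : D →ₗc[k] C) (g : D →ₗ[k] M) :
    TensorProduct.lift (a * b).ofConv ∘ₗ LinearMap.comulPair f.toLinearMap g =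
      TensorProduct.lift a.ofConv ∘ₗ LinearMap.comulPair f.toLinearMap
        (TensorProduct.lift b.ofConv ∘ₗ LinearMap.comulPair f.toLinearMap g) := by
  rw [lift_convMul, LinearMap.comp_assoc, LinearMap.comp_assoc, LinearMap.comp_assoc,
    LinearMap.rTensor_comp_comulPair, LinearMap.comul_comp_coalgHom,
    LinearMap.assoc_comp_comulPair, LinearMap.lTensor_comp_comulPair]

theorem TensorProduct.lift_convOne_comp_comulPair [Coalgebra k M] [IsCocomm k D] (f : D →ₗc[k] C)
    (g : D →ₗc[k] M) :
    TensorProduct.lift (1 : WithConv (C →ₗ[k] Module.End k M)).ofConv ∘ₗ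
      LinearMap.comulPair f.toLinearMap g.toLinearMap = g.toLinearMap := by
  have h : TensorProduct.lift (1 : WithConv (C →ₗ[k] Module.End k M)).ofConv =
      (CoalgHom.snd k C M).toLinearMap :=
    TensorProduct.ext' fun _ _ => rfl
  rw [h]
  exact congrArg CoalgHom.toLinearMap (CoalgHom.snd_comp_comulPair f g)

variable [Coalgebra k M] [IsCocomm k C] [IsCocomm k M]

/-- If `a : C → End M` is convolution invertible and `c ⊗ m ↦ a_c m` is a coalgebra homomorphism,
then so is `c ⊗ m ↦ b_c m` for the convolution inverse `b` of `a`: the map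
`c ⊗ m ↦ c₁ ⊗ b_{c₂} m` is the inverse of the bijective coalgebra homomorphism
`c ⊗ m ↦ c₁ ⊗ a_{c₂} m`. -/
theorem exists_coalgHom_eq_lift_of_conv_inverse (a b : WithConv (C →ₗ[k] Module.End k M))
    (hab : a * b = 1) (hba : b * a = 1) (F : C ⊗[k] M →ₗc[k] M)
    (hF : F.toLinearMap = TensorProduct.lift a.ofConv) :
    ∃ G : C ⊗[k] M →ₗc[k] M, G.toLinearMap = TensorProduct.lift b.ofConv := by
  let p := CoalgHom.fst k C M
  let q := CoalgHom.snd k C M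
  have hpq : LinearMap.comulPair p.toLinearMap q.toLinearMap = LinearMap.id :=
    congrArg CoalgHom.toLinearMap CoalgHom.comulPair_fst_snd
  -- `shear c` is `x ⊗ m ↦ x₁ ⊗ c_{x₂} m`; the next two facts give `shear c ∘ shear d = id` whenever
  -- `c` and `d` are mutually inverse, without assuming `shear d` to be a coalgebra homomorphism.
  let shear (c : WithConv (C →ₗ[k] Module.End k M)) : C ⊗[k] M →ₗ[k] C ⊗[k] M :=
    LinearMap.comulPair p.toLinearMap (TensorProduct.lift c.ofConv)
  have shear_eq (c) : shear c = LinearMap.lTensor C (TensorProduct.lift c.ofConv) ∘ₗ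
      (TensorProduct.assoc k C C M).toLinearMap ∘ₗ LinearMap.rTensor M comul := by
    rw [← LinearMap.comp_id (LinearMap.rTensor M comul), ← hpq, LinearMap.rTensor_comp_comulPair,
      LinearMap.comul_comp_coalgHom, LinearMap.assoc_comp_comulPair,
      LinearMap.lTensor_comp_comulPair, hpq, LinearMap.comp_id]
  have shear_comp (c d) (h : c * d = 1) : shear c ∘ₗ shear d = LinearMap.id := by
    rw [shear_eq c, LinearMap.comp_assoc, LinearMap.comp_assoc, LinearMap.rTensor_comp_comulPair,
      LinearMap.comul_comp_coalgHom, LinearMap.assoc_comp_comulPair,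
      LinearMap.lTensor_comp_comulPair]
    have := TensorProduct.lift_convMul_comp_comulPair c d p q.toLinearMap
    rw [h, TensorProduct.lift_convOne_comp_comulPair, hpq, LinearMap.comp_id] at this
    rw [← this, hpq]
  let Φ : C ⊗[k] M →ₗc[k] C ⊗[k] M := CoalgHom.comulPair p F
  have hΦ : Φ.toLinearMap = shear a := by rw [CoalgHom.toLinearMap_comulPair, hF]
  have hΦ_apply (t) : Φ t = shear a t := LinearMap.congr_fun hΦ t
  have hbij : Function.Bijective Φ := by
    refine Function.bijective_iff_has_inverse.2 ⟨shear b, fun t => ?_, fun t => ?_⟩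
    · rw [hΦ_apply]; exact LinearMap.congr_fun (shear_comp b a hba) t
    · rw [hΦ_apply]; exact LinearMap.congr_fun (shear_comp a b hab) t
  -- `b_c m` is the second component of the inverse of `Φ` at `c ⊗ m`.
  refine ⟨q.comp (CoalgEquiv.ofBijective hbij).symm, LinearMap.ext fun t => ?_⟩
  obtain ⟨s, rfl⟩ := hbij.2 t
  have h₁ : (CoalgEquiv.ofBijective hbij).symm (Φ s) = s :=
    (CoalgEquiv.ofBijective hbij).symm_apply_apply s
  have h₂ := TensorProduct.lift_convMul_comp_comulPair b a p q.toLinearMap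
  rw [hba, TensorProduct.lift_convOne_comp_comulPair, hpq, LinearMap.comp_id] at h₂
  change q ((CoalgEquiv.ofBijective hbij).symm (Φ s)) = _
  rw [h₁, hΦ_apply]
  exact LinearMap.congr_fun h₂ s

end ConvInverse

/-! ### The group of points of a cocommutative Hopf algebra -/

section Points

open Coalgebra WithConv

variable (k H : Type*) [Field k] [Ring H] [HopfAlgebra k H] [IsCocomm k H]

/-- The antipode of a cocommutative Hopf algebra is a coalgebra homomorphism: `x ⊗ y ↦ S(x) y` is
the convolution inverse of the multiplication `x ⊗ y ↦ x y`. -/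
theorem HopfAlgebra.exists_coalgHom_eq_antipode :
    ∃ S : H →ₗc[k] H, S.toLinearMap = HopfAlgebra.antipode k (A := H) := by
  let L := Algebra.lmul k H
  have h (f g : WithConv (H →ₗ[k] H)) :
      toConv (L.toLinearMap ∘ₗ f.ofConv) * toConv (L.toLinearMap ∘ₗ g.ofConv) =
        toConv (L.toLinearMap ∘ₗ (f * g).ofConv) := by
    rw [LinearMap.algHom_comp_convMul_distrib]
  have h₁ : toConv (L.toLinearMap ∘ₗ (1 : WithConv (H →ₗ[k] H)).ofConv) = 1 :=
    WithConv.ext (LinearMap.ext fun x => L.commutes (counit x))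
  obtain ⟨G, hG⟩ := exists_coalgHom_eq_lift_of_conv_inverse
    (toConv (L.toLinearMap ∘ₗ .id)) (toConv (L.toLinearMap ∘ₗ HopfAlgebra.antipode k))
    ((h (toConv .id) (toConv (HopfAlgebra.antipode k))).trans
      (by rw [LinearMap.id_mul_antipode, h₁]))
    ((h (toConv (HopfAlgebra.antipode k)) (toConv .id)).trans
      (by rw [LinearMap.antipode_mul_id, h₁]))
    (Bialgebra.mulCoalgHom k H) (TensorProduct.ext' fun _ _ => rfl)
  -- `S(x)` is the value of `x ⊗ y ↦ S(x) y` at `x ⊗ 1`.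
  refine ⟨G.comp (((Coalgebra.TensorProduct.map (CoalgHom.id k H)
    (Bialgebra.unitBialgHom k H).toCoalgHom).comp
      ((Coalgebra.TensorProduct.rid k k H).symm : H →ₗc[k] H ⊗[k] k))), LinearMap.ext fun x => ?_⟩
  change G.toLinearMap (x ⊗ₜ algebraMap k H 1) = _
  rw [hG]
  simp [L]

/-- The antipode of a cocommutative Hopf algebra, as a coalgebra homomorphism. -/
noncomputable def HopfAlgebra.antipodeCoalgHom : H →ₗc[k] H :=
  (HopfAlgebra.exists_coalgHom_eq_antipode k H).choose

theorem HopfAlgebra.toLinearMap_antipodeCoalgHom :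
    (HopfAlgebra.antipodeCoalgHom k H).toLinearMap = HopfAlgebra.antipode k :=
  (HopfAlgebra.exists_coalgHom_eq_antipode k H).choose_spec

variable {k H} {C : Type*} [AddCommGroup C] [Module k C] [Coalgebra k C]

namespace CoalgHom

/-- The convolution product `c ↦ f(c₁) g(c₂)` of coalgebra homomorphisms; it is again a coalgebra
homomorphism because the source is cocommutative. -/
noncomputable instance convMul {H : Type*} [Ring H] [HopfAlgebra k H] [IsCocomm k C] :
    Mul (WithConv (C →ₗc[k] H)) :=
  ⟨fun f g => toConv ((Bialgebra.mulCoalgHom k H).comp (comulPair f.ofConv g.ofConv))⟩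

/-- The convolution unit `c ↦ ε(c) 1`. -/
noncomputable instance convOne {H : Type*} [Ring H] [HopfAlgebra k H] :
    One (WithConv (C →ₗc[k] H)) :=
  ⟨toConv ((Bialgebra.unitBialgHom k H).toCoalgHom.comp (counitCoalgHom k C))⟩

/-- The convolution inverse `c ↦ S(f(c))`. -/
noncomputable instance convInv : Inv (WithConv (C →ₗc[k] H)) :=
  ⟨fun f => toConv ((HopfAlgebra.antipodeCoalgHom k H).comp f.ofConv)⟩

theorem toConv_toLinearMap_injective {H : Type*} [AddCommGroup H] [Module k H] [Coalgebra k H] :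
    Function.Injective fun f : WithConv (C →ₗc[k] H) => toConv f.ofConv.toLinearMap :=
  fun _ _ h => WithConv.ext (toLinearMap_injective (congrArg WithConv.ofConv h))

theorem toConv_mul_comp {H D : Type*} [Ring H] [HopfAlgebra k H] [AddCommGroup D] [Module k D]
    [Coalgebra k D] [IsCocomm k C] [IsCocomm k D] (f g : WithConv (C →ₗc[k] H)) (h : D →ₗc[k] C) :
    toConv ((f * g).ofConv.comp h) = toConv (f.ofConv.comp h) * toConv (g.ofConv.comp h) :=
  congrArg (fun w => toConv ((Bialgebra.mulCoalgHom k H).comp w))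
    (comulPair_comp f.ofConv g.ofConv h)

/-- The coalgebra homomorphisms from a cocommutative coalgebra to a cocommutative Hopf algebra form
a group under convolution. -/
noncomputable instance convGroup [IsCocomm k C] : Group (WithConv (C →ₗc[k] H)) :=
  Group.ofRightAxioms
    (fun f g h => toConv_toLinearMap_injective (mul_assoc (toConv f.ofConv.toLinearMap)
      (toConv g.ofConv.toLinearMap) (toConv h.ofConv.toLinearMap)))
    (fun f => toConv_toLinearMap_injective (mul_one (toConv f.ofConv.toLinearMap)))
    (fun f => by
      apply toConv_toLinearMap_injective
      have h := LinearMap.convMul_comp_coalgHom_distrib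
        (toConv LinearMap.id) (toConv (HopfAlgebra.antipode k (A := H))) f.ofConv
      rw [LinearMap.id_mul_antipode] at h
      have h₁ : (1 : WithConv (H →ₗ[k] H)).ofConv ∘ₗ f.ofConv.toLinearMap =
          (1 : WithConv (C →ₗ[k] H)).ofConv := by
        change (_ ∘ₗ counit) ∘ₗ f.ofConv.toLinearMap = _
        rw [LinearMap.comp_assoc, f.ofConv.counit_comp]
        rfl
      rw [h₁, ← HopfAlgebra.toLinearMap_antipodeCoalgHom] at h
      exact (WithConv.ext h).symm)

end CoalgHom

end Points

/-! ### The points of a post-Hopf algebra -/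

namespace PostHopfAlgebra

open Coalgebra WithConv

variable {k H : Type*} [Field k] [Ring H] [HopfAlgebra k H] (P : PostHopfAlgebra k H)

theorem lift_leftMul : TensorProduct.lift P.leftMul = P.act.toLinearMap :=
  TensorProduct.ext' fun _ _ => rfl

variable [IsCocomm k H]

/-- The convolution inverse of `x ↦ (y ↦ x ▷ y)` is again given by a coalgebra homomorphism. -/
theorem exists_coalgHom_eq_lift_convInv :
    ∃ G : H ⊗[k] H →ₗc[k] H, G.toLinearMap = TensorProduct.lift P.convInv :=
  exists_coalgHom_eq_lift_of_conv_inverse (toConv P.leftMul) (toConv P.convInv)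
    P.leftMul_conv_convInv.1 P.leftMul_conv_convInv.2 P.act P.lift_leftMul.symm

/-- The coalgebra homomorphism `x ⊗ y ↦ β_x y`, where `β` is the convolution inverse of
`x ↦ (y ↦ x ▷ y)`. -/
noncomputable def actInv : H ⊗[k] H →ₗc[k] H :=
  P.exists_coalgHom_eq_lift_convInv.choose

theorem toLinearMap_actInv : P.actInv.toLinearMap = TensorProduct.lift P.convInv :=
  P.exists_coalgHom_eq_lift_convInv.choose_spec

variable (C : Type*) [AddCommGroup C] [Module k C] [Coalgebra k C] [IsCocomm k C]

/-- The post-group structure, induced by a post-Hopf algebra structure on `H`, on the group of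
coalgebra homomorphisms from a cocommutative coalgebra to `H`. -/
noncomputable def postGroup : PostGroup (WithConv (C →ₗc[k] H)) where
  act f g := toConv (P.act.comp (CoalgHom.comulPair f.ofConv g.ofConv))
  actInv f g := toConv (P.actInv.comp (CoalgHom.comulPair f.ofConv g.ofConv))
  act_mul f g h := by
    apply CoalgHom.toConv_toLinearMap_injective
    have e : P.act.toLinearMap ∘ₗ LinearMap.lTensor H (LinearMap.mul' k H) =
        LinearMap.mul' k H ∘ₗ TensorProduct.map P.act.toLinearMap P.act.toLinearMap ∘ₗ
          (TensorProduct.tensorTensorTensorComm k H H H H).toLinearMap ∘ₗ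
            LinearMap.rTensor (H ⊗[k] H) comul :=
      TensorProduct.ext_threefold' fun x y z => P.act_mul x y z
    have e' := congrArg (· ∘ₗ LinearMap.comulPair f.ofConv.toLinearMap
      (LinearMap.comulPair g.ofConv.toLinearMap h.ofConv.toLinearMap)) e
    simp only [LinearMap.comp_assoc] at e'
    rw [LinearMap.lTensor_comp_comulPair, LinearMap.rTensor_comp_comulPair,
      LinearMap.comul_comp_coalgHom, LinearMap.tensorTensorTensorComm_comp_comulPair,
      LinearMap.map_comp_comulPair] at e'
    exact congrArg toConv e'
  act_act f g h := by
    apply CoalgHom.toConv_toLinearMap_injective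
    have e : P.act.toLinearMap ∘ₗ LinearMap.lTensor H P.act.toLinearMap =
        P.act.toLinearMap ∘ₗ LinearMap.rTensor H (LinearMap.mul' k H ∘ₗ
          LinearMap.lTensor H P.act.toLinearMap ∘ₗ
            (TensorProduct.assoc k H H H).toLinearMap ∘ₗ LinearMap.rTensor H comul) ∘ₗ
          (TensorProduct.assoc k H H H).symm.toLinearMap :=
      TensorProduct.ext_threefold' fun x y z => P.act_act x y z
    have e' := congrArg (· ∘ₗ LinearMap.comulPair f.ofConv.toLinearMap
      (LinearMap.comulPair g.ofConv.toLinearMap h.ofConv.toLinearMap)) e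
    simp only [LinearMap.comp_assoc] at e'
    rw [LinearMap.lTensor_comp_comulPair, LinearMap.assoc_symm_comp_comulPair,
      LinearMap.rTensor_comp_comulPair, LinearMap.comp_assoc, LinearMap.comp_assoc,
      LinearMap.comp_assoc, LinearMap.rTensor_comp_comulPair,
      LinearMap.comul_comp_coalgHom, LinearMap.assoc_comp_comulPair,
      LinearMap.lTensor_comp_comulPair] at e'
    exact congrArg toConv e'
  act_actInv f g := by
    apply CoalgHom.toConv_toLinearMap_injective
    have e := TensorProduct.lift_convMul_comp_comulPair (toConv P.leftMul) (toConv P.convInv)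
      f.ofConv g.ofConv.toLinearMap
    rw [P.leftMul_conv_convInv.1, TensorProduct.lift_convOne_comp_comulPair, ofConv_toConv,
      ofConv_toConv, lift_leftMul, ← toLinearMap_actInv] at e
    exact congrArg toConv e.symm
  actInv_act f g := by
    apply CoalgHom.toConv_toLinearMap_injective
    have e := TensorProduct.lift_convMul_comp_comulPair (toConv P.convInv) (toConv P.leftMul)
      f.ofConv g.ofConv.toLinearMap
    rw [P.leftMul_conv_convInv.2, TensorProduct.lift_convOne_comp_comulPair, ofConv_toConv,
      ofConv_toConv, lift_leftMul, ← toLinearMap_actInv] at e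
    exact congrArg toConv e.symm

variable {C}

theorem star_comp_comulPair (f g : WithConv (C →ₗc[k] H)) :
    P.star ∘ₗ LinearMap.comulPair f.ofConv.toLinearMap g.ofConv.toLinearMap =
      ((P.postGroup C).star f g).ofConv.toLinearMap := by
  rw [star, LinearMap.comp_assoc, LinearMap.comp_assoc,
    LinearMap.comp_assoc, LinearMap.rTensor_comp_comulPair,
    LinearMap.comul_comp_coalgHom, LinearMap.assoc_comp_comulPair,
    LinearMap.lTensor_comp_comulPair]
  rfl

theorem subAntipode_comp (f : WithConv (C →ₗc[k] H)) :
    P.subAntipode ∘ₗ f.ofConv.toLinearMap = ((P.postGroup C).starInv f).ofConv.toLinearMap := by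
  rw [subAntipode, LinearMap.comp_assoc, LinearMap.comp_assoc, LinearMap.comul_comp_coalgHom,
    LinearMap.lTensor_comp_comulPair, ← toLinearMap_actInv,
    ← HopfAlgebra.toLinearMap_antipodeCoalgHom]
  rfl

theorem rightAct_comp_comulPair (f g : WithConv (C →ₗc[k] H)) :
    P.rightAct ∘ₗ LinearMap.comulPair f.ofConv.toLinearMap g.ofConv.toLinearMap =
      ((P.postGroup C).rightAct f g).ofConv.toLinearMap := by
  rw [rightAct, LinearMap.comp_assoc, LinearMap.comp_assoc, ← CoalgHom.toLinearMap_comulPair,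
    LinearMap.comul_comp_coalgHom, LinearMap.map_comp_comulPair, CoalgHom.toLinearMap_comulPair,
    star_comp_comulPair, LinearMap.comp_assoc]
  have h := P.subAntipode_comp ((P.postGroup C).act f g)
  refine Eq.trans ?_ (P.star_comp_comulPair _ _)
  rw [← h]
  rfl

/-- On pairs of points, the braiding is `(f, g) ↦ (f ▷ g, f ◁ g)`. -/
theorem braiding_comp_comulPair (f g : WithConv (C →ₗc[k] H)) :
    P.braiding ∘ₗ LinearMap.comulPair f.ofConv.toLinearMap g.ofConv.toLinearMap =
      LinearMap.comulPair ((P.postGroup C).act f g).ofConv.toLinearMap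
        ((P.postGroup C).rightAct f g).ofConv.toLinearMap := by
  rw [braiding, LinearMap.comp_assoc, ← CoalgHom.toLinearMap_comulPair,
    LinearMap.comul_comp_coalgHom, LinearMap.map_comp_comulPair, CoalgHom.toLinearMap_comulPair,
    rightAct_comp_comulPair]
  rfl

/-! The operations on points are natural in the coalgebra: they commute with precomposition. -/

section Naturality

variable {D : Type*} [AddCommGroup D] [Module k D] [Coalgebra k D] [IsCocomm k D]

theorem toConv_act_comp (f g : WithConv (C →ₗc[k] H)) (h : D →ₗc[k] C) :
    toConv (((P.postGroup C).act f g).ofConv.comp h) =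
      (P.postGroup D).act (toConv (f.ofConv.comp h)) (toConv (g.ofConv.comp h)) :=
  congrArg (fun w => toConv (P.act.comp w)) (CoalgHom.comulPair_comp f.ofConv g.ofConv h)

theorem toConv_actInv_comp (f g : WithConv (C →ₗc[k] H)) (h : D →ₗc[k] C) :
    toConv (((P.postGroup C).actInv f g).ofConv.comp h) =
      (P.postGroup D).actInv (toConv (f.ofConv.comp h)) (toConv (g.ofConv.comp h)) :=
  congrArg (fun w => toConv (P.actInv.comp w)) (CoalgHom.comulPair_comp f.ofConv g.ofConv h)

theorem toConv_braidInvFst_comp (f g : WithConv (C →ₗc[k] H)) (h : D →ₗc[k] C) :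
    toConv (((P.postGroup C).braidInvFst f g).ofConv.comp h) =
      (P.postGroup D).braidInvFst (toConv (f.ofConv.comp h)) (toConv (g.ofConv.comp h)) := by
  rw [PostGroup.braidInvFst, CoalgHom.toConv_mul_comp, PostGroup.star, CoalgHom.toConv_mul_comp,
    toConv_act_comp]
  rfl

theorem toConv_braidInvSnd_comp (f g : WithConv (C →ₗc[k] H)) (h : D →ₗc[k] C) :
    toConv (((P.postGroup C).braidInvSnd f g).ofConv.comp h) =
      (P.postGroup D).braidInvSnd (toConv (f.ofConv.comp h)) (toConv (g.ofConv.comp h)) := by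
  rw [PostGroup.braidInvSnd, toConv_actInv_comp, toConv_braidInvFst_comp]
  rfl

end Naturality

/-! ### The braiding -/

/-- The first projection of `A ⊗ B`, regarded as a point of `A` defined on `A ⊗ B`. -/
noncomputable abbrev fstPoint (A B : Type*) [AddCommGroup A] [Module k A] [Coalgebra k A]
    [AddCommGroup B] [Module k B] [Coalgebra k B] : WithConv (A ⊗[k] B →ₗc[k] A) :=
  toConv (CoalgHom.fst k A B)

/-- The second projection of `A ⊗ B`, regarded as a point of `B` defined on `A ⊗ B`. -/
noncomputable abbrev sndPoint (A B : Type*) [AddCommGroup A] [Module k A] [Coalgebra k A]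
    [AddCommGroup B] [Module k B] [Coalgebra k B] : WithConv (A ⊗[k] B →ₗc[k] B) :=
  toConv (CoalgHom.snd k A B)

theorem comulPair_fst_snd_toLinearMap (A B : Type*) [AddCommGroup A] [Module k A] [Coalgebra k A]
    [IsCocomm k A] [AddCommGroup B] [Module k B] [Coalgebra k B] [IsCocomm k B] :
    LinearMap.comulPair (CoalgHom.fst k A B).toLinearMap (CoalgHom.snd k A B).toLinearMap =
      LinearMap.id :=
  congrArg CoalgHom.toLinearMap CoalgHom.comulPair_fst_snd

/-- The braiding as a coalgebra homomorphism: the value of `(f, g) ↦ (f ▷ g, f ◁ g)` at the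
universal pair of points, formed by the two projections of `H ⊗ H`. -/
noncomputable def braidingHom : H ⊗[k] H →ₗc[k] H ⊗[k] H :=
  CoalgHom.comulPair
    ((P.postGroup (H ⊗[k] H)).act (fstPoint H H) (sndPoint H H)).ofConv
    ((P.postGroup (H ⊗[k] H)).rightAct (fstPoint H H) (sndPoint H H)).ofConv

/-- The inverse of the braiding, obtained from that of `(f, g) ↦ (f ▷ g, f ◁ g)` at the universal
pair of points. -/
noncomputable def braidingInvHom : H ⊗[k] H →ₗc[k] H ⊗[k] H :=
  CoalgHom.comulPair
    ((P.postGroup (H ⊗[k] H)).braidInvFst (fstPoint H H) (sndPoint H H)).ofConv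
    ((P.postGroup (H ⊗[k] H)).braidInvSnd (fstPoint H H) (sndPoint H H)).ofConv

theorem toLinearMap_braidingHom : P.braidingHom.toLinearMap = P.braiding := by
  rw [← LinearMap.comp_id P.braiding, ← comulPair_fst_snd_toLinearMap]
  exact (P.braiding_comp_comulPair (fstPoint H H) (sndPoint H H)).symm

theorem braidingHom_comp_braidingInvHom :
    P.braidingHom.comp P.braidingInvHom = CoalgHom.id k (H ⊗[k] H) := by
  apply CoalgHom.toLinearMap_injective
  rw [CoalgHom.toLinearMap_comp, toLinearMap_braidingHom, braidingInvHom,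
    CoalgHom.toLinearMap_comulPair, braiding_comp_comulPair, PostGroup.act_braidInv,
    PostGroup.rightAct_braidInv]
  exact comulPair_fst_snd_toLinearMap H H

theorem braidingInvHom_comp_braidingHom :
    P.braidingInvHom.comp P.braidingHom = CoalgHom.id k (H ⊗[k] H) := by
  have h₁ : toConv ((fstPoint H H).ofConv.comp P.braidingHom) =
      (P.postGroup (H ⊗[k] H)).act (fstPoint H H) (sndPoint H H) :=
    congrArg toConv (CoalgHom.fst_comp_comulPair _ _)
  have h₂ : toConv ((sndPoint H H).ofConv.comp P.braidingHom) =
      (P.postGroup (H ⊗[k] H)).rightAct (fstPoint H H) (sndPoint H H) :=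
    congrArg toConv (CoalgHom.snd_comp_comulPair _ _)
  have e₁ := P.toConv_braidInvFst_comp (fstPoint H H) (sndPoint H H) P.braidingHom
  have e₂ := P.toConv_braidInvSnd_comp (fstPoint H H) (sndPoint H H) P.braidingHom
  rw [h₁, h₂, PostGroup.braidInvFst_braid] at e₁
  rw [h₁, h₂, PostGroup.braidInvSnd_braid] at e₂
  rw [← CoalgHom.comulPair_fst_snd, braidingInvHom, CoalgHom.comulPair_comp]
  exact congrArg₂ CoalgHom.comulPair (congrArg WithConv.ofConv e₁) (congrArg WithConv.ofConv e₂)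

/-- The braiding of the first two factors, on triples of points. -/
theorem braiding_rTensor_comp (f g h : WithConv (C →ₗc[k] H)) :
    ((TensorProduct.assoc k H H H).toLinearMap ∘ₗ LinearMap.rTensor H P.braiding ∘ₗ
        (TensorProduct.assoc k H H H).symm.toLinearMap) ∘ₗ
        LinearMap.comulPair f.ofConv.toLinearMap
          (LinearMap.comulPair g.ofConv.toLinearMap h.ofConv.toLinearMap) =
      LinearMap.comulPair ((P.postGroup C).act f g).ofConv.toLinearMap
        (LinearMap.comulPair ((P.postGroup C).rightAct f g).ofConv.toLinearMap
          h.ofConv.toLinearMap) := by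
  rw [LinearMap.comp_assoc, LinearMap.comp_assoc, LinearMap.assoc_symm_comp_comulPair,
    LinearMap.rTensor_comp_comulPair, braiding_comp_comulPair, LinearMap.assoc_comp_comulPair]

/-- The braiding of the last two factors, on triples of points. -/
theorem braiding_lTensor_comp (f g h : WithConv (C →ₗc[k] H)) :
    LinearMap.lTensor H P.braiding ∘ₗ LinearMap.comulPair f.ofConv.toLinearMap
        (LinearMap.comulPair g.ofConv.toLinearMap h.ofConv.toLinearMap) =
      LinearMap.comulPair f.ofConv.toLinearMap
        (LinearMap.comulPair ((P.postGroup C).act g h).ofConv.toLinearMap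
          ((P.postGroup C).rightAct g h).ofConv.toLinearMap) := by
  rw [LinearMap.lTensor_comp_comulPair, braiding_comp_comulPair]

theorem isYangBaxterSolution_braiding : IsYangBaxterSolution P.braiding := by
  refine ⟨?_, ?_⟩
  · rw [← toLinearMap_braidingHom]
    exact Function.bijective_iff_has_inverse.2 ⟨P.braidingInvHom,
      fun t => DFunLike.congr_fun P.braidingInvHom_comp_braidingHom t,
      fun t => DFunLike.congr_fun P.braidingHom_comp_braidingInvHom t⟩
  · intro R₁₂ R₂₃
    -- It suffices to evaluate both sides at the universal triple of points of `H`, formed by the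
    -- three projections of `H ⊗ (H ⊗ H)`.
    let x : WithConv (H ⊗[k] (H ⊗[k] H) →ₗc[k] H) := fstPoint H (H ⊗[k] H)
    let y : WithConv (H ⊗[k] (H ⊗[k] H) →ₗc[k] H) :=
      toConv ((CoalgHom.fst k H H).comp (CoalgHom.snd k H (H ⊗[k] H)))
    let z : WithConv (H ⊗[k] (H ⊗[k] H) →ₗc[k] H) :=
      toConv ((CoalgHom.snd k H H).comp (CoalgHom.snd k H (H ⊗[k] H)))
    have hxyz : LinearMap.comulPair x.ofConv.toLinearMap
        (LinearMap.comulPair y.ofConv.toLinearMap z.ofConv.toLinearMap) = LinearMap.id := by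
      have hyz : LinearMap.comulPair y.ofConv.toLinearMap z.ofConv.toLinearMap =
          (CoalgHom.snd k H (H ⊗[k] H)).toLinearMap :=
        congrArg CoalgHom.toLinearMap ((CoalgHom.comulPair_comp (CoalgHom.fst k H H)
          (CoalgHom.snd k H H) (CoalgHom.snd k H (H ⊗[k] H))).symm.trans
            (by rw [CoalgHom.comulPair_fst_snd, CoalgHom.id_comp]))
      rw [hyz]
      exact comulPair_fst_snd_toLinearMap H (H ⊗[k] H)
    obtain ⟨h₁, h₂, h₃⟩ := (P.postGroup (H ⊗[k] (H ⊗[k] H))).braid_relation x y z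
    have key : (R₁₂ ∘ₗ R₂₃ ∘ₗ R₁₂) ∘ₗ LinearMap.comulPair x.ofConv.toLinearMap
        (LinearMap.comulPair y.ofConv.toLinearMap z.ofConv.toLinearMap) =
        (R₂₃ ∘ₗ R₁₂ ∘ₗ R₂₃) ∘ₗ LinearMap.comulPair x.ofConv.toLinearMap
          (LinearMap.comulPair y.ofConv.toLinearMap z.ofConv.toLinearMap) := by
      have r₁₂ : ∀ f g h, R₁₂ ∘ₗ _ = _ := P.braiding_rTensor_comp (C := H ⊗[k] (H ⊗[k] H))
      have r₂₃ : ∀ f g h, R₂₃ ∘ₗ _ = _ := P.braiding_lTensor_comp (C := H ⊗[k] (H ⊗[k] H))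
      -- Opaque values keep the reassociation below from unfolding `R₁₂`.
      clear_value R₁₂ R₂₃
      iterate 4 rw [LinearMap.comp_assoc]
      rw [r₁₂, r₂₃, r₁₂, r₂₃, r₁₂, r₂₃, h₁, h₂, h₃]
    rwa [hxyz, LinearMap.comp_id, LinearMap.comp_id] at key

end PostHopfAlgebra

theorem mainTheorem2 {k H : Type*} [Field k] [IsAlgClosed k] [CharZero k]
    [Ring H] [HopfAlgebra k H] [Coalgebra.IsCocomm k H] (P : PostHopfAlgebra k H) :
    (∃ e : (H ⊗[k] H) ≃ₗc[k] (H ⊗[k] H), ∀ t : H ⊗[k] H, e t = P.braiding t) ∧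
      IsYangBaxterSolution P.braiding :=
  ⟨⟨CoalgEquiv.ofCoalgHom P.braidingHom P.braidingInvHom P.braidingHom_comp_braidingInvHom
    P.braidingInvHom_comp_braidingHom, fun t => LinearMap.congr_fun P.toLinearMap_braidingHom t⟩,
    P.isYangBaxterSolution_braiding⟩
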